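/- Let $m,n\ge 1$ and $C\ge 0$ be integers with $1<n/m<2$, and let $q=\max\{m,n\}=n$. Consider the two-user linear deterministic Z-interference channel over $\mathbb F_2$: in each channel use, transmitter 1 sends $\mathbf x_1\in\mathbb F_2^{m}$, transmitter 2 sends $\mathbf x_2\in\mathbb F_2^{q}$, and the receivers observe $$\mathbf y_1=\mathbf D^{q-m}\mathbf x_1\oplus \mathbf D^{q-n}\mathbf x_2,\qquad \mathbf y_2=\mathbf D^{q-m}\mathbf x_2,$$ where $\mathbf D$ is the $q\times q$ downshift matrix, $\mathbf x_1$ is padded at the bottom with zeros to length $q$, and the $q-m$ top entries of $\mathbf y_2$, which are always $0$, are dropped. A noiseless and secure link carries $C$ bits per channel use from transmitter 2 to transmitter 1. A code of block length $N$ has independent uniform messages $W_1,W_2$. Transmitter 2 computes the link signal $\mathbf v_{21}^N$ and its input $\mathbf x_2^N$ from $W_2$ and local randomness. Transmitter 1 computes its input at time $t$ from $W_1$, its own independent local randomness and the link signal up to time $t$. Receiver $i$ estimates $W_i$ from $\mathbf y_i^N$. A pair $(R_1,R_2)$ of non-negative reals is achievable if for every $\varepsilon>0$ and all sufficiently large $N$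 there is such a code with at least $2^{NR_i}$ messages for user $i$, error probability at most $\varepsilon$ at each receiver, and perfect secrecy, $I(W_1;\mathbf y_2^N)=I(W_2;\mathbf y_1^N)=0$. The secrecy capacity region is the closure of the set of achievable pairs. Then the secrecy capacity region is exactly $$\{(R_1,R_2)\in\mathbb R_{\ge0}^2:\ R_1\le m,\ R_2\le 2m-n,\ R_1+R_2\le m+C\}.$$ Moreover, if $C\le 2m-n$, the corner points $(m,C)$ and $(C+n-m,\,2m-n)$ are achievable. -/

import Mathlib

noncomputable section

namespace ZIC

/-! ### Entropy and mutual information of random variables on a finite probability space -/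

section Information

variable {Ω α β : Type} [Fintype Ω] [Fintype α] [Fintype β]

open Classical in
/-- Probability of the event `E` under the probability mass function `p`. -/
def prob (p : Ω → ℝ) (E : Set Ω) : ℝ := ∑ ω, if ω ∈ E then p ω else 0

/-- Shannon entropy, in bits, of the random variable `X`. -/
def entropy (p : Ω → ℝ) (X : Ω → α) : ℝ :=
  ∑ a, Real.negMulLog (prob p {ω | X ω = a}) / Real.log 2

/-- Mutual information `I(X; Y) = H(X) + H(Y) - H(X, Y)`, in bits. -/
def mutualInfo (p : Ω → ℝ) (X : Ω → α) (Y : Ω → β) : ℝ :=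
  entropy p X + entropy p Y - entropy p (fun ω => (X ω, Y ω))

end Information

/-! ### The linear deterministic Z-interference channel

A vector over `𝔽₂` is indexed from the top (most significant) level, which has index `0`, down to
the bottom level. -/

/-- The `q × q` downshift matrix over `𝔽₂`: ones directly below the diagonal, zeros elsewhere. -/
def downshift (q : ℕ) : Matrix (Fin q) (Fin q) (ZMod 2) :=
  Matrix.of fun i j => if (i : ℕ) = (j : ℕ) + 1 then 1 else 0

/-- A vector of length `m` as a vector of length `max m n`; the new bottom entries are `0`. -/
def pad (m n : ℕ) (x : Fin m → ZMod 2) : Fin (max m n) → ZMod 2 :=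
  fun i => if h : (i : ℕ) < m then x ⟨i, h⟩ else 0

/-- Output at receiver 1: `y₁ = D^(q-m) x₁ ⊕ D^(q-n) x₂`, where `q = max m n`. -/
def output₁ (m n : ℕ) (x₁ : Fin m → ZMod 2) (x₂ : Fin (max m n) → ZMod 2) :
    Fin (max m n) → ZMod 2 :=
  (downshift (max m n) ^ (max m n - m)).mulVec (pad m n x₁) +
    (downshift (max m n) ^ (max m n - n)).mulVec x₂

/-- Output at receiver 2: `y₂ = D^(q-m) x₂`, where `q = max m n`. The top `q - m` entries of this
vector vanish identically, and `y₂` consists of the `m` other ones. -/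
def output₂ (m n : ℕ) (x₂ : Fin (max m n) → ZMod 2) : Fin m → ZMod 2 :=
  fun i => (downshift (max m n) ^ (max m n - m)).mulVec x₂
    ⟨max m n - m + (i : ℕ), by have := i.isLt; omega⟩

/-! ### Codes with a cooperative link from transmitter 2 to transmitter 1 -/

/-- A code of block length `N` for the deterministic Z-interference channel with parameters `m`,
`n` whose noiseless link from transmitter 2 to transmitter 1 carries `C` bits per channel use.
Transmitter `i` has local randomness on `K i` values (a stochastic encoder with a finite input and
output alphabet needs no more than finitely many values). Transmitter 1 uses the link causally. -/
structure Code (m n C N : ℕ) where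
  /-- number of messages of user 1 -/
  M₁ : ℕ
  /-- number of messages of user 2 -/
  M₂ : ℕ
  /-- number of values of the local randomness of transmitter 1 -/
  K₁ : ℕ
  /-- number of values of the local randomness of transmitter 2 -/
  K₂ : ℕ
  /-- distribution of the local randomness of transmitter 1 -/
  p₁ : Fin K₁ → ℝ
  p₁_mem : p₁ ∈ stdSimplex ℝ (Fin K₁)
  /-- distribution of the local randomness of transmitter 2 -/
  p₂ : Fin K₂ → ℝ
  p₂_mem : p₂ ∈ stdSimplex ℝ (Fin K₂)
  /-- signal sent over the cooperative link -/
  link : Fin M₂ → Fin K₂ → (Fin N → Fin C → ZMod 2)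
  /-- encoder of transmitter 1, as a function of its message, its randomness and the link signal -/
  enc₁ : Fin M₁ → Fin K₁ → (Fin N → Fin C → ZMod 2) → (Fin N → Fin m → ZMod 2)
  /-- the channel input at time `t` does not depend on the link signal after time `t` -/
  causal : ∀ w u v v' t, (∀ s, s ≤ t → v s = v' s) → enc₁ w u v t = enc₁ w u v' t
  /-- encoder of transmitter 2 -/
  enc₂ : Fin M₂ → Fin K₂ → (Fin N → Fin (max m n) → ZMod 2)
  /-- decoder of receiver 1 -/
  dec₁ : (Fin N → Fin (max m n) → ZMod 2) → Fin M₁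
  /-- decoder of receiver 2 -/
  dec₂ : (Fin N → Fin m → ZMod 2) → Fin M₂

namespace Code

variable {m n C N : ℕ} (c : Code m n C N)

/-- The sample space: the two messages, then the local randomness of the two transmitters. -/
abbrev Sample : Type := (Fin c.M₁ × Fin c.M₂) × (Fin c.K₁ × Fin c.K₂)

/-- The messages are uniform, and messages and local randomness are all independent. -/
def pmf (ω : c.Sample) : ℝ :=
  (1 / (c.M₁ : ℝ)) * (1 / (c.M₂ : ℝ)) * c.p₁ ω.2.1 * c.p₂ ω.2.2

/-- Message of user 1. -/
def W₁ (ω : c.Sample) : Fin c.M₁ := ω.1.1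

/-- Message of user 2. -/
def W₂ (ω : c.Sample) : Fin c.M₂ := ω.1.2

/-- Signal on the cooperative link. -/
def V (ω : c.Sample) : Fin N → Fin C → ZMod 2 := c.link ω.1.2 ω.2.2

/-- Channel input block of transmitter 1. -/
def X₁ (ω : c.Sample) : Fin N → Fin m → ZMod 2 := c.enc₁ ω.1.1 ω.2.1 (c.V ω)

/-- Channel input block of transmitter 2. -/
def X₂ (ω : c.Sample) : Fin N → Fin (max m n) → ZMod 2 := c.enc₂ ω.1.2 ω.2.2

/-- Channel output block at receiver 1. -/
def Y₁ (ω : c.Sample) : Fin N → Fin (max m n) → ZMod 2 :=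
  fun t => output₁ m n (c.X₁ ω t) (c.X₂ ω t)

/-- Channel output block at receiver 2. -/
def Y₂ (ω : c.Sample) : Fin N → Fin m → ZMod 2 := fun t => output₂ m n (c.X₂ ω t)

/-- Probability of a decoding error at receiver 1. -/
def err₁ : ℝ := prob c.pmf {ω | c.dec₁ (c.Y₁ ω) ≠ c.W₁ ω}

/-- Probability of a decoding error at receiver 2. -/
def err₂ : ℝ := prob c.pmf {ω | c.dec₂ (c.Y₂ ω) ≠ c.W₂ ω}

/-- Perfect secrecy: neither receiver learns anything about the other user's message. -/
def PerfectlySecret : Prop :=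
  mutualInfo c.pmf c.W₁ c.Y₂ = 0 ∧ mutualInfo c.pmf c.W₂ c.Y₁ = 0

end Code

/-- The rate pair `R` (in bits per channel use) is achievable with perfect secrecy. -/
def IsAchievable (m n C : ℕ) (R : ℝ × ℝ) : Prop :=
  0 ≤ R.1 ∧ 0 ≤ R.2 ∧
    ∀ ε : ℝ, 0 < ε → ∃ N₀ : ℕ, ∀ N : ℕ, N₀ ≤ N → ∃ c : Code m n C N,
      (2 : ℝ) ^ ((N : ℝ) * R.1) ≤ (c.M₁ : ℝ) ∧ (2 : ℝ) ^ ((N : ℝ) * R.2) ≤ (c.M₂ : ℝ) ∧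
      c.err₁ ≤ ε ∧ c.err₂ ≤ ε ∧ c.PerfectlySecret

/-- The secrecy capacity region: the closure of the set of achievable rate pairs. -/
def secrecyCapacityRegion (m n C : ℕ) : Set (ℝ × ℝ) :=
  closure {R | IsAchievable m n C R}

end ZIC

end

/-! Converse. The top `n - m` levels of `x₂` reach receiver 1 without interference, so secrecy makes
them independent of `W₂`. Receiver 2 sees them together with `2m - n` further levels, and only the
latter can carry `W₂`: up to Fano terms, `H(W₂) ≤ H(Y₂) - H(top) ≤ N(2m - n)` (`logb_M₂_le_entropy`,
`entropy_Y₂_le`). For user 1, `Y₁` has at most `H(top) + Nm` bits, but part of this is interference: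
knowing everything at transmitter 1 including the link signal, `Y₁` reveals `Y₂`, and the link
accounts for at most `NC` bits of it. Hence `H(W₁) ≤ H(top) - H(Y₂) + N(m + C)`
(`logb_M₁_le_entropy`). Adding the bound on `H(W₂)` cancels both entropies and gives the sum bound.
The bound `R₁ ≤ m` comes from revealing transmitter 2 to receiver 1 (`logb_M₁_le`).

Achievability. User 2 places uncoded bits in the `2m - n` levels seen by both receivers and zeros
elsewhere. A bit shared over the link is cancelled at receiver 1 by transmitter 1, which still sends
its own bit on that level; a bit not shared is hidden under a random bit, which costs user 1 one
bit. Errors vanish and secrecy is exact for every `N` (`exists_code`). Trading hidden bits for bits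
of user 1 position by position sweeps the dominant face of the region, so no time sharing between
codes is needed. -/

namespace ZIC

/-! ### Entropy inequalities on a finite probability space -/

section EntropyInequalities

variable {Ω α β γ : Type} [Fintype Ω] [Fintype α] [Fintype β] [Fintype γ] {p : Ω → ℝ}

open Classical in
theorem prob_eq_sum {α : Type} (p : Ω → ℝ) (X : Ω → α) (a : α) :
    prob p {ω | X ω = a} = ∑ ω, if X ω = a then p ω else 0 := by
  simp [prob]

theorem prob_nonneg (hp : p ∈ stdSimplex ℝ Ω) (E : Set Ω) : 0 ≤ prob p E := by
  unfold prob
  refine Finset.sum_nonneg fun ω _ => ?_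
  split_ifs
  exacts [hp.1 ω, le_rfl]

theorem prob_mono (hp : p ∈ stdSimplex ℝ Ω) {E F : Set Ω} (h : E ⊆ F) : prob p E ≤ prob p F := by
  unfold prob
  refine Finset.sum_le_sum fun ω _ => ?_
  by_cases hE : ω ∈ E
  · simp [hE, h hE]
  · simp only [hE, if_false]
    split_ifs
    exacts [hp.1 ω, le_rfl]

theorem le_prob (hp : p ∈ stdSimplex ℝ Ω) {E : Set Ω} {ω : Ω} (h : ω ∈ E) : p ω ≤ prob p E := by
  classical
  unfold prob
  have := Finset.single_le_sum (f := fun ω => if ω ∈ E then p ω else 0) (s := Finset.univ)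
    (fun i _ => by split_ifs; exacts [hp.1 i, le_rfl]) (Finset.mem_univ ω)
  simpa [h] using this

theorem sum_prob_mul (p : Ω → ℝ) (X : Ω → α) (f : α → ℝ) :
    ∑ a, prob p {ω | X ω = a} * f a = ∑ ω, p ω * f (X ω) := by
  classical
  simp_rw [prob_eq_sum, Finset.sum_mul]
  rw [Finset.sum_comm]
  refine Finset.sum_congr rfl fun ω _ => ?_
  rw [Finset.sum_eq_single (X ω)]
  · simp
  · intro b _ hb
    simp [hb.symm]
  · simp

theorem sum_prob_eq_one (hp : p ∈ stdSimplex ℝ Ω) (X : Ω → α) :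
    ∑ a, prob p {ω | X ω = a} = 1 := by
  have := sum_prob_mul p X (fun _ => 1)
  simpa [hp.2] using this

/-- Marginalization of the second variable. -/
theorem sum_prob_pair {α : Type} (p : Ω → ℝ) (X : Ω → α) (Y : Ω → β) (a : α) :
    ∑ b, prob p {ω | (X ω, Y ω) = (a, b)} = prob p {ω | X ω = a} := by
  classical
  simp_rw [prob_eq_sum]
  rw [Finset.sum_comm]
  refine Finset.sum_congr rfl fun ω _ => ?_
  rw [Finset.sum_eq_single (Y ω)]
  · simp
  · intro b _ hb
    simp [hb.symm]
  · simp

/-- Entropy as the expected self-information. -/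
theorem entropy_eq_sum (p : Ω → ℝ) (X : Ω → α) :
    entropy p X = ∑ ω, p ω * -Real.logb 2 (prob p {ω' | X ω' = X ω}) := by
  rw [← sum_prob_mul p X fun a => -Real.logb 2 (prob p {ω' | X ω' = a})]
  unfold entropy
  refine Finset.sum_congr rfl fun a _ => ?_
  rw [Real.negMulLog, Real.logb]
  ring

/-- Gibbs' inequality. -/
theorem entropy_le_cross (hp : p ∈ stdSimplex ℝ Ω) (X : Ω → α) (g : α → ℝ) (hg : ∀ a, 0 ≤ g a)
    (hpos : ∀ ω, 0 < p ω → 0 < g (X ω)) (hsum : ∑ a, g a ≤ 1) :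
    entropy p X ≤ ∑ ω, p ω * -Real.logb 2 (g (X ω)) := by
  have hlog : 0 < Real.log 2 := Real.log_pos one_lt_two
  have hterm : ∀ ω, p ω * -Real.logb 2 (prob p {ω' | X ω' = X ω}) - p ω * -Real.logb 2 (g (X ω)) ≤
      (p ω * (g (X ω) / prob p {ω' | X ω' = X ω}) - p ω) / Real.log 2 := by
    intro ω
    rcases (hp.1 ω).eq_or_lt with h0 | h0
    · simp [← h0]
    · have hP : 0 < prob p {ω' | X ω' = X ω} := h0.trans_le (le_prob hp rfl)
      -- The inequality `log x ≤ x - 1` at `x = g / P`; averaged over `p`, its right side is at most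
      -- `0`.
      have h1 := Real.log_le_sub_one_of_pos (div_pos (hpos ω h0) hP)
      rw [Real.log_div (hpos ω h0).ne' hP.ne'] at h1
      rw [Real.logb, Real.logb, le_div_iff₀ hlog]
      have h2 := mul_le_mul_of_nonneg_left h1 h0.le
      field_simp
      field_simp at h2
      linarith
  have hS : ∑ ω, p ω * (g (X ω) / prob p {ω' | X ω' = X ω}) ≤ 1 := by
    rw [← sum_prob_mul p X fun a => g a / prob p {ω' | X ω' = a}]
    refine le_trans (Finset.sum_le_sum fun a _ => ?_) hsum
    rcases (prob_nonneg hp {ω | X ω = a}).eq_or_lt with h0 | h0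
    · rw [← h0]; simpa using hg a
    · rw [mul_div_cancel₀ _ h0.ne']
  rw [entropy_eq_sum, ← sub_nonpos, ← Finset.sum_sub_distrib]
  refine (Finset.sum_le_sum fun ω _ => hterm ω).trans ?_
  rw [← Finset.sum_div, Finset.sum_sub_distrib, hp.2]
  exact div_nonpos_of_nonpos_of_nonneg (by linarith) hlog.le

/-- If `X` determines `Y`, then `H(Y) ≤ H(X)`. -/
theorem entropy_le_of_determines (hp : p ∈ stdSimplex ℝ Ω) {X : Ω → α} {Y : Ω → β}
    (h : ∀ ω ω', X ω = X ω' → Y ω = Y ω') : entropy p Y ≤ entropy p X := by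
  rw [entropy_eq_sum, entropy_eq_sum]
  refine Finset.sum_le_sum fun ω _ => ?_
  rcases (hp.1 ω).eq_or_lt with h0 | h0
  · simp [← h0]
  · refine mul_le_mul_of_nonneg_left (neg_le_neg ?_) h0.le
    exact Real.logb_le_logb_of_le one_lt_two (h0.trans_le (le_prob hp rfl))
      (prob_mono hp fun ω' hω' => h ω' ω hω')

theorem entropy_le_logb_card (hp : p ∈ stdSimplex ℝ Ω) (X : Ω → α) :
    entropy p X ≤ Real.logb 2 (Fintype.card α) := by
  have hpos : ∀ ω : Ω, 0 < (Fintype.card α : ℝ) := fun ω => by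
    have : Nonempty α := ⟨X ω⟩
    exact_mod_cast Fintype.card_pos
  refine (entropy_le_cross hp X (fun _ => (Fintype.card α : ℝ)⁻¹) (fun _ => by positivity)
    (fun ω _ => inv_pos.2 (hpos ω)) ?_).trans ?_
  · simpa using mul_inv_le_one
  · simp [Real.logb_inv, ← Finset.sum_mul, hp.2]

/-- Submodularity of entropy: `H(X, Y, Z) + H(Z) ≤ H(X, Z) + H(Y, Z)`. -/
theorem entropy_submodular (hp : p ∈ stdSimplex ℝ Ω) (X : Ω → α) (Y : Ω → β) (Z : Ω → γ) :
    entropy p (fun ω => (X ω, Y ω, Z ω)) + entropy p Z ≤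
      entropy p (fun ω => (Z ω, X ω)) + entropy p (fun ω => (Z ω, Y ω)) := by
  set PX : γ → α → ℝ := fun z x => prob p {ω | (Z ω, X ω) = (z, x)} with hPX
  set PY : γ → β → ℝ := fun z y => prob p {ω | (Z ω, Y ω) = (z, y)} with hPY
  set PZ : γ → ℝ := fun z => prob p {ω | Z ω = z} with hPZ
  have hX : ∀ ω, 0 < p ω → 0 < PX (Z ω) (X ω) := fun ω h => h.trans_le (le_prob hp rfl)
  have hY : ∀ ω, 0 < p ω → 0 < PY (Z ω) (Y ω) := fun ω h => h.trans_le (le_prob hp rfl)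
  have hZ : ∀ ω, 0 < p ω → 0 < PZ (Z ω) := fun ω h => h.trans_le (le_prob hp rfl)
  -- The comparison law is `P(x,z) P(y,z) / P(z)`, under which `X` and `Y` are conditionally
  -- independent given `Z`.
  have key := entropy_le_cross hp (fun ω => (X ω, Y ω, Z ω))
    (fun a => PX a.2.2 a.1 * PY a.2.2 a.2.1 / PZ a.2.2)
    (fun a => div_nonneg (mul_nonneg (prob_nonneg hp _) (prob_nonneg hp _)) (prob_nonneg hp _))
    (fun ω h => div_pos (mul_pos (hX ω h) (hY ω h)) (hZ ω h)) (by
      rw [Fintype.sum_prod_type_right]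
      rw [Fintype.sum_prod_type_right]
      rw [← sum_prob_eq_one hp Z]
      refine Finset.sum_le_sum fun z _ => ?_
      simp_rw [← Finset.sum_div, ← Finset.sum_mul]
      simp only [hPX, hPY, hPZ]
      simp_rw [sum_prob_pair, ← Finset.mul_sum, sum_prob_pair]
      -- This also covers `P(z) = 0`, where division by zero returns `0`.
      rw [mul_self_div_self])
  have hsum : ∑ ω, p ω * -Real.logb 2 (PX (Z ω) (X ω) * PY (Z ω) (Y ω) / PZ (Z ω)) =
      entropy p (fun ω => (Z ω, X ω)) + entropy p (fun ω => (Z ω, Y ω)) - entropy p Z := by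
    rw [entropy_eq_sum, entropy_eq_sum, entropy_eq_sum, ← Finset.sum_add_distrib,
      ← Finset.sum_sub_distrib]
    refine Finset.sum_congr rfl fun ω _ => ?_
    rcases (hp.1 ω).eq_or_lt with h0 | h0
    · simp [← h0]
    · rw [Real.logb_div (mul_pos (hX ω h0) (hY ω h0)).ne' (hZ ω h0).ne',
        Real.logb_mul (hX ω h0).ne' (hY ω h0).ne']
      ring
  simp only [] at key
  linarith

theorem entropy_pair_le_add (hp : p ∈ stdSimplex ℝ Ω) (X : Ω → α) (Y : Ω → β) :
    entropy p (fun ω => (X ω, Y ω)) ≤ entropy p X + entropy p Y := by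
  have h := entropy_submodular hp X Y (fun _ => ())
  have h1 : entropy p (fun ω => (X ω, Y ω)) ≤ entropy p (fun ω => (X ω, Y ω, ())) :=
    entropy_le_of_determines hp fun _ _ h => by simpa using h
  have h2 : entropy p (fun ω => ((), X ω)) ≤ entropy p X :=
    entropy_le_of_determines hp fun _ _ h => by simpa using h
  have h3 : entropy p (fun ω => ((), Y ω)) ≤ entropy p Y :=
    entropy_le_of_determines hp fun _ _ h => by simpa using h
  have h4 : 0 ≤ entropy p (fun _ : Ω => ()) := by
    have hc : prob p Set.univ = 1 := by simpa [prob] using hp.2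
    simp [entropy, hc]
  linarith

theorem mutualInfo_eq_zero_of_indep (hp : p ∈ stdSimplex ℝ Ω) {X : Ω → α} {Y : Ω → β}
    (h : ∀ a b, prob p {ω | (X ω, Y ω) = (a, b)} =
      prob p {ω | X ω = a} * prob p {ω | Y ω = b}) : mutualInfo p X Y = 0 := by
  rw [mutualInfo, entropy_eq_sum, entropy_eq_sum, entropy_eq_sum, ← Finset.sum_add_distrib,
    ← Finset.sum_sub_distrib]
  refine Finset.sum_eq_zero fun ω _ => ?_
  rcases (hp.1 ω).eq_or_lt with h0 | h0
  · simp [← h0]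
  · have hX : 0 < prob p {ω' | X ω' = X ω} := h0.trans_le (le_prob hp rfl)
    have hY : 0 < prob p {ω' | Y ω' = Y ω} := h0.trans_le (le_prob hp rfl)
    rw [h, Real.logb_mul hX.ne' hY.ne']
    ring

/-- Data processing: if `I(X; Y) = 0` and `Y` determines `Z`, then `I(X; Z) ≤ 0`. -/
theorem entropy_add_le_of_mutualInfo_eq_zero (hp : p ∈ stdSimplex ℝ Ω) {X : Ω → α} {Y : Ω → β}
    {Z : Ω → γ} (h : ∀ ω ω', Y ω = Y ω' → Z ω = Z ω') (h0 : mutualInfo p X Y = 0) :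
    entropy p X + entropy p Z ≤ entropy p (fun ω => (X ω, Z ω)) := by
  have h1 := entropy_submodular hp X Y Z
  have h2 : entropy p (fun ω => (X ω, Y ω)) ≤ entropy p (fun ω => (X ω, Y ω, Z ω)) :=
    entropy_le_of_determines hp fun _ _ h => by simp_all
  have h3 : entropy p (fun ω => (Z ω, Y ω)) ≤ entropy p Y :=
    entropy_le_of_determines hp fun ω ω' h' => by simp [h', h ω ω' h']
  have h4 : entropy p (fun ω => (Z ω, X ω)) ≤ entropy p (fun ω => (X ω, Z ω)) :=
    entropy_le_of_determines hp fun _ _ h => by simp_all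
  rw [mutualInfo] at h0
  linarith

/-- Fano's inequality. -/
theorem fano (hp : p ∈ stdSimplex ℝ Ω) (W : Ω → α) (Y : Ω → β) (dec : β → α) :
    entropy p (fun ω => (W ω, Y ω)) ≤ entropy p Y + 1 +
      prob p {ω | dec (Y ω) ≠ W ω} * Real.logb 2 (Fintype.card α) := by
  classical
  set M : ℝ := (Fintype.card α : ℝ)
  have hM : ∀ ω : Ω, 0 < M := fun ω => by
    have : Nonempty α := ⟨W ω⟩
    exact Nat.cast_pos.2 Fintype.card_pos
  have hM0 : 0 ≤ M := Nat.cast_nonneg _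
  have hY : ∀ ω, 0 < p ω → 0 < prob p {ω' | Y ω' = Y ω} := fun ω h => h.trans_le (le_prob hp rfl)
  have hw : ∀ ω : Ω, 0 < (if dec (Y ω) = W ω then 1 / 2 else 1 / (2 * M)) := fun ω => by
    have := hM ω
    split_ifs <;> positivity
  -- The comparison law guesses `W` from `Y`: weight `1/2` on the decoded value, `1/(2M)` on every
  -- other. A correct guess costs one bit, a wrong one `1 + log M`.
  have key := entropy_le_cross hp (fun ω => (W ω, Y ω))
    (fun a => prob p {ω | Y ω = a.2} * if dec a.2 = a.1 then 1 / 2 else 1 / (2 * M))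
    (fun a => mul_nonneg (prob_nonneg hp _) (by split_ifs <;> positivity))
    (fun ω h => mul_pos (hY ω h) (hw ω)) (by
      rw [Fintype.sum_prod_type_right]
      refine le_trans (Finset.sum_le_sum fun y _ => ?_) (sum_prob_eq_one hp Y).le
      dsimp only
      rw [← Finset.mul_sum]
      refine mul_le_of_le_one_right (prob_nonneg hp _) ?_
      have : ∀ w, (if dec y = w then (1 : ℝ) / 2 else 1 / (2 * M)) ≤
          (if dec y = w then (1 : ℝ) / 2 else 0) + 1 / (2 * M) := fun w => by
        have : 0 ≤ 1 / (2 * M) := by positivity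
        split_ifs <;> linarith
      refine (Finset.sum_le_sum fun w _ => this w).trans ?_
      rw [Finset.sum_add_distrib, Finset.sum_ite_eq]
      simp only [Finset.mem_univ, if_true, Finset.sum_const, Finset.card_univ, nsmul_eq_mul]
      have : M * (1 / (2 * M)) ≤ 1 / 2 := by
        rcases hM0.eq_or_lt with h | h
        · simp [← h]
        · field_simp; exact le_rfl
      change 1 / 2 + M * (1 / (2 * M)) ≤ 1
      linarith)
  refine key.trans (le_of_eq ?_)
  -- With the constant `1` written as the total mass, both sides agree term by term in `ω`.
  trans entropy p Y + ∑ ω, p ω + prob p {ω | dec (Y ω) ≠ W ω} * Real.logb 2 M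
  swap
  · rw [hp.2]
  rw [entropy_eq_sum, prob, Finset.sum_mul, ← Finset.sum_add_distrib, ← Finset.sum_add_distrib]
  refine Finset.sum_congr rfl fun ω _ => ?_
  rcases (hp.1 ω).eq_or_lt with h0 | h0
  · simp [← h0]
  · have h2 : Real.logb 2 2 = 1 := Real.logb_self_eq_one one_lt_two
    dsimp only
    rw [Real.logb_mul (hY ω h0).ne' (hw ω).ne']
    have h3 : Real.logb 2 (1 / 2) = -1 := by rw [one_div, Real.logb_inv, h2]
    have h4 : Real.logb 2 (1 / (2 * M)) = -(1 + Real.logb 2 M) := by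
      rw [one_div, Real.logb_inv, Real.logb_mul two_ne_zero (hM ω).ne', h2]
    by_cases hd : dec (Y ω) = W ω
    · rw [if_pos hd, if_neg (fun h : ω ∈ {ω | dec (Y ω) ≠ W ω} => h hd), h3]
      ring
    · rw [if_neg hd, if_pos (show ω ∈ {ω | dec (Y ω) ≠ W ω} from hd), h4]
      ring

end EntropyInequalities
end ZIC
namespace ZIC

/-! ### The channel, level by level -/

section Channel

theorem downshift_pow_mulVec (q k : ℕ) (x : Fin q → ZMod 2) (i : Fin q) :
    ((downshift q) ^ k).mulVec x i =
      if h : k ≤ i then x ⟨i - k, by omega⟩ else 0 := by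
  induction k generalizing i with
  | zero => simp
  | succ k ih =>
    have h1 : ∀ (y : Fin q → ZMod 2) (i : Fin q), (downshift q).mulVec y i =
        if h : 1 ≤ (i : ℕ) then y ⟨i - 1, by omega⟩ else 0 := by
      intro y i
      simp only [Matrix.mulVec, dotProduct, downshift, Matrix.of_apply, ite_mul, one_mul, zero_mul]
      split_ifs with h
      · rw [Finset.sum_eq_single (⟨i - 1, by omega⟩ : Fin q)]
        · rw [if_pos (by simp; omega)]
        · intro b _ hb
          rw [if_neg]
          intro hb'
          exact hb (Fin.ext (by simp; omega))
        · simp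
      · exact Finset.sum_eq_zero fun j _ => if_neg (by omega)
    rw [pow_succ', ← Matrix.mulVec_mulVec, h1]
    by_cases h : 1 ≤ (i : ℕ)
    · rw [dif_pos h, ih]
      by_cases h' : k + 1 ≤ (i : ℕ)
      · rw [dif_pos h', dif_pos (by simp; omega)]
        congr 1
        exact Fin.ext (by simp; omega)
      · rw [dif_neg h', dif_neg (by simp; omega)]
    · rw [dif_neg h, dif_neg (by omega)]

theorem output₁_of_lt {m n : ℕ} (hmn : m ≤ n) (x₁ : Fin m → ZMod 2) (x₂ : Fin (max m n) → ZMod 2)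
    (i : Fin (max m n)) (h : (i : ℕ) < n - m) : output₁ m n x₁ x₂ i = x₂ i := by
  simp only [output₁, Pi.add_apply, downshift_pow_mulVec]
  rw [dif_neg (by omega), dif_pos (by omega), zero_add]
  congr 1
  exact Fin.ext (by simp; omega)

theorem output₁_of_le {m n : ℕ} (hmn : m ≤ n) (x₁ : Fin m → ZMod 2) (x₂ : Fin (max m n) → ZMod 2)
    (i : Fin (max m n)) (h : n - m ≤ (i : ℕ)) :
    output₁ m n x₁ x₂ i = x₁ ⟨i - (n - m), by omega⟩ + x₂ i := by
  simp only [output₁, Pi.add_apply, downshift_pow_mulVec]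
  rw [dif_pos (by omega), dif_pos (by omega), pad, dif_pos (by simp; omega)]
  congr 2
  · exact Fin.ext (by simp; omega)
  · exact Fin.ext (by simp; omega)

theorem output₂_apply {m n : ℕ} (x₂ : Fin (max m n) → ZMod 2) (i : Fin m) :
    output₂ m n x₂ i = x₂ ⟨i, by omega⟩ := by
  simp only [output₂, downshift_pow_mulVec]
  rw [dif_pos (by simp)]
  congr 1
  exact Fin.ext (by simp)

end Channel

/-! ### Independence of the two transmitters -/

namespace Code

variable {m n C N : ℕ} (c : Code m n C N)

/-- Message and local randomness of transmitter 1. -/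
def local₁ (ω : c.Sample) : Fin c.M₁ × Fin c.K₁ := (ω.1.1, ω.2.1)

/-- Message and local randomness of transmitter 2. -/
def local₂ (ω : c.Sample) : Fin c.M₂ × Fin c.K₂ := (ω.1.2, ω.2.2)

/-- The sample law is a product of the laws at the two transmitters. Total mass, marginals and
independence are all obtained from this by choosing `φ` and `ψ`. -/
theorem sum_pmf_mul (φ : Fin c.M₁ × Fin c.K₁ → ℝ) (ψ : Fin c.M₂ × Fin c.K₂ → ℝ) :
    ∑ ω, c.pmf ω * (φ (c.local₁ ω) * ψ (c.local₂ ω)) =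
      (∑ a, 1 / (c.M₁ : ℝ) * c.p₁ a.2 * φ a) * ∑ b, 1 / (c.M₂ : ℝ) * c.p₂ b.2 * ψ b := by
  rw [Finset.sum_mul_sum, ← Fintype.sum_prod_type',
    ← (Equiv.prodProdProdComm (Fin c.M₁) (Fin c.M₂) (Fin c.K₁) (Fin c.K₂)).sum_comp]
  refine Finset.sum_congr rfl fun ω _ => ?_
  simp only [pmf, local₁, local₂, Equiv.prodProdProdComm_apply]
  ring

theorem sum_local₁ (h : c.M₁ ≠ 0) : ∑ a : Fin c.M₁ × Fin c.K₁, 1 / (c.M₁ : ℝ) * c.p₁ a.2 = 1 := by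
  rw [Fintype.sum_prod_type]
  simp [← Finset.mul_sum, c.p₁_mem.2, h]

theorem sum_local₂ (h : c.M₂ ≠ 0) : ∑ b : Fin c.M₂ × Fin c.K₂, 1 / (c.M₂ : ℝ) * c.p₂ b.2 = 1 := by
  rw [Fintype.sum_prod_type]
  simp [← Finset.mul_sum, c.p₂_mem.2, h]

theorem pmf_mem (h₁ : c.M₁ ≠ 0) (h₂ : c.M₂ ≠ 0) : c.pmf ∈ stdSimplex ℝ c.Sample := by
  refine ⟨fun ω => ?_, ?_⟩
  · have := c.p₁_mem.1 ω.2.1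
    have := c.p₂_mem.1 ω.2.2
    unfold pmf
    positivity
  · have := c.sum_pmf_mul (fun _ => 1) (fun _ => 1)
    simpa only [mul_one, c.sum_local₁ h₁, c.sum_local₂ h₂] using this

theorem prob_local₁ (h₂ : c.M₂ ≠ 0) (S : Set (Fin c.M₁ × Fin c.K₁)) [DecidablePred (· ∈ S)] :
    prob c.pmf {ω | c.local₁ ω ∈ S} =
      ∑ a, 1 / (c.M₁ : ℝ) * c.p₁ a.2 * if a ∈ S then 1 else 0 := by
  have := c.sum_pmf_mul (fun a => if a ∈ S then 1 else 0) (fun _ => 1)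
  simp only [mul_one, c.sum_local₂ h₂] at this
  rw [← this]
  simp only [prob, mul_ite, mul_one, mul_zero, Set.mem_ofPred_eq]
  exact Finset.sum_congr rfl fun _ _ => by congr

theorem prob_local₂ (h₁ : c.M₁ ≠ 0) (S : Set (Fin c.M₂ × Fin c.K₂)) [DecidablePred (· ∈ S)] :
    prob c.pmf {ω | c.local₂ ω ∈ S} =
      ∑ b, 1 / (c.M₂ : ℝ) * c.p₂ b.2 * if b ∈ S then 1 else 0 := by
  have := c.sum_pmf_mul (fun _ => 1) (fun b => if b ∈ S then 1 else 0)
  simp only [one_mul, mul_one, c.sum_local₁ h₁] at this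
  rw [← this]
  simp only [prob, mul_ite, mul_one, mul_zero, Set.mem_ofPred_eq]
  exact Finset.sum_congr rfl fun _ _ => by congr

/-- What depends on transmitter 1 alone is independent of what depends on transmitter 2 alone. -/
theorem prob_local_inter (h₁ : c.M₁ ≠ 0) (h₂ : c.M₂ ≠ 0) (S : Set (Fin c.M₁ × Fin c.K₁))
    (T : Set (Fin c.M₂ × Fin c.K₂)) :
    prob c.pmf {ω | c.local₁ ω ∈ S ∧ c.local₂ ω ∈ T} =
      prob c.pmf {ω | c.local₁ ω ∈ S} * prob c.pmf {ω | c.local₂ ω ∈ T} := by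
  classical
  rw [c.prob_local₁ h₂, c.prob_local₂ h₁, ← c.sum_pmf_mul, prob]
  refine Finset.sum_congr rfl fun ω _ => ?_
  by_cases h : c.local₁ ω ∈ S <;> by_cases h' : c.local₂ ω ∈ T <;> simp [h, h']

theorem mutualInfo_local_eq_zero {α β : Type} [Fintype α] [Fintype β] (h₁ : c.M₁ ≠ 0)
    (h₂ : c.M₂ ≠ 0) (f : Fin c.M₁ × Fin c.K₁ → α) (g : Fin c.M₂ × Fin c.K₂ → β) :
    mutualInfo c.pmf (fun ω => f (c.local₁ ω)) (fun ω => g (c.local₂ ω)) = 0 := by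
  refine mutualInfo_eq_zero_of_indep (c.pmf_mem h₁ h₂) fun a b => ?_
  simp only [Prod.mk.injEq]
  exact c.prob_local_inter h₁ h₂ {x | f x = a} {y | g y = b}

theorem prob_W₁ (h₂ : c.M₂ ≠ 0) (w : Fin c.M₁) :
    prob c.pmf {ω | c.W₁ ω = w} = 1 / c.M₁ := by
  have := c.prob_local₁ h₂ {a | a.1 = w}
  change prob c.pmf {ω | c.W₁ ω = w} = _ at this
  rw [this, Fintype.sum_prod_type]
  simp [Finset.sum_ite_irrel, ← Finset.mul_sum, c.p₁_mem.2]

theorem prob_W₂ (h₁ : c.M₁ ≠ 0) (w : Fin c.M₂) :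
    prob c.pmf {ω | c.W₂ ω = w} = 1 / c.M₂ := by
  have := c.prob_local₂ h₁ {a | a.1 = w}
  change prob c.pmf {ω | c.W₂ ω = w} = _ at this
  rw [this, Fintype.sum_prod_type]
  simp [Finset.sum_ite_irrel, ← Finset.mul_sum, c.p₂_mem.2]

theorem entropy_W₁ (h₁ : c.M₁ ≠ 0) (h₂ : c.M₂ ≠ 0) :
    entropy c.pmf c.W₁ = Real.logb 2 c.M₁ := by
  rw [entropy_eq_sum]
  simp_rw [c.prob_W₁ h₂]
  simp [Real.logb_inv, ← Finset.sum_mul, (c.pmf_mem h₁ h₂).2]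

theorem entropy_W₂ (h₁ : c.M₁ ≠ 0) (h₂ : c.M₂ ≠ 0) :
    entropy c.pmf c.W₂ = Real.logb 2 c.M₂ := by
  rw [entropy_eq_sum]
  simp_rw [c.prob_W₂ h₁]
  simp [Real.logb_inv, ← Finset.sum_mul, (c.pmf_mem h₁ h₂).2]

/-- The top `n - m` levels of the input of transmitter 2. -/
def top (ω : c.Sample) : Fin N → Fin (n - m) → ZMod 2 := fun t i => c.X₂ ω t ⟨i, by omega⟩

variable {c}

theorem Y₁_determines_top (hmn : m ≤ n) (ω ω' : c.Sample) (h : c.Y₁ ω = c.Y₁ ω') :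
    c.top ω = c.top ω' := by
  funext t i
  have := congrFun (congrFun h t) ⟨i, by omega⟩
  simp only [Y₁] at this
  rwa [output₁_of_lt hmn _ _ _ i.2, output₁_of_lt hmn _ _ _ i.2] at this

theorem X₁_determined {ω ω' : c.Sample} (hA : c.local₁ ω = c.local₁ ω') (hV : c.V ω = c.V ω') :
    c.X₁ ω = c.X₁ ω' := by
  simp only [local₁, Prod.mk.injEq] at hA
  simp only [X₁, hA, hV]

theorem Y₂_determined {ω ω' : c.Sample} (hA : c.local₁ ω = c.local₁ ω') (hV : c.V ω = c.V ω')
    (hmn : m ≤ n) (hY : c.Y₁ ω = c.Y₁ ω') : c.Y₂ ω = c.Y₂ ω' := by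
  have hX := X₁_determined hA hV
  funext t i
  simp only [Y₂, output₂_apply]
  have := congrFun (congrFun hY t) ⟨i, by omega⟩
  simp only [Y₁, hX] at this
  by_cases h : (i : ℕ) < n - m
  · rwa [output₁_of_lt hmn _ _ _ h, output₁_of_lt hmn _ _ _ h] at this
  · rw [output₁_of_le hmn _ _ _ (not_lt.1 h), output₁_of_le hmn _ _ _ (not_lt.1 h)] at this
    exact add_left_cancel this

theorem entropy_block_le {Ω : Type} [Fintype Ω] {p : Ω → ℝ} (hp : p ∈ stdSimplex ℝ Ω) {k : ℕ}
    (X : Ω → Fin N → Fin k → ZMod 2) : entropy p X ≤ N * k := by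
  refine (entropy_le_logb_card hp X).trans (le_of_eq ?_)
  simp [Real.logb_pow, ZMod.card]

/-! ### Entropy bounds for a single code -/

variable (c)

theorem entropy_local_pair {α β : Type} [Fintype α] [Fintype β] (h₁ : c.M₁ ≠ 0)
    (h₂ : c.M₂ ≠ 0) (f : Fin c.M₁ × Fin c.K₁ → α) (g : Fin c.M₂ × Fin c.K₂ → β) :
    entropy c.pmf (fun ω => (f (c.local₁ ω), g (c.local₂ ω))) =
      entropy c.pmf (fun ω => f (c.local₁ ω)) + entropy c.pmf (fun ω => g (c.local₂ ω)) := by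
  have := c.mutualInfo_local_eq_zero h₁ h₂ f g
  rw [mutualInfo] at this
  linarith

theorem fano₁ (h₁ : c.M₁ ≠ 0) (h₂ : c.M₂ ≠ 0) :
    entropy c.pmf (fun ω => (c.W₁ ω, c.Y₁ ω)) ≤
      entropy c.pmf c.Y₁ + 1 + c.err₁ * Real.logb 2 c.M₁ := by
  simpa [err₁] using fano (c.pmf_mem h₁ h₂) c.W₁ c.Y₁ c.dec₁

theorem fano₂ (h₁ : c.M₁ ≠ 0) (h₂ : c.M₂ ≠ 0) :
    entropy c.pmf (fun ω => (c.W₂ ω, c.Y₂ ω)) ≤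
      entropy c.pmf c.Y₂ + 1 + c.err₂ * Real.logb 2 c.M₂ := by
  simpa [err₂] using fano (c.pmf_mem h₁ h₂) c.W₂ c.Y₂ c.dec₂

/-- If receiver 1 is given all that transmitter 2 knows, which is independent of `W₁`, the only
remaining uncertainty in `Y₁` is `X₁`, of at most `N m` bits. -/
theorem logb_M₁_le (h₁ : c.M₁ ≠ 0) (h₂ : c.M₂ ≠ 0) :
    Real.logb 2 c.M₁ ≤ N * m + 1 + c.err₁ * Real.logb 2 c.M₁ := by
  have hp := c.pmf_mem h₁ h₂
  have hF := c.fano₁ h₁ h₂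
  have hS := entropy_submodular hp c.W₁ c.local₂ c.Y₁
  have e1 : entropy c.pmf (fun ω => (c.W₁ ω, c.local₂ ω)) ≤
      entropy c.pmf (fun ω => (c.W₁ ω, c.local₂ ω, c.Y₁ ω)) :=
    entropy_le_of_determines hp fun _ _ h => by simp_all
  have e2 : entropy c.pmf (fun ω => (c.Y₁ ω, c.W₁ ω)) ≤
      entropy c.pmf (fun ω => (c.W₁ ω, c.Y₁ ω)) :=
    entropy_le_of_determines hp fun _ _ h => by simp_all
  have e3 : entropy c.pmf (fun ω => (c.Y₁ ω, c.local₂ ω)) ≤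
      entropy c.pmf (fun ω => (c.X₁ ω, c.local₂ ω)) :=
    entropy_le_of_determines hp fun ω ω' h => by
      simp only [Prod.mk.injEq] at h ⊢
      refine ⟨?_, h.2⟩
      have h2 := h.2
      simp only [local₂, Prod.mk.injEq] at h2
      funext t
      simp only [Y₁, X₂, h.1, h2]
  have e4 := entropy_pair_le_add hp c.X₁ c.local₂
  have e5 := entropy_block_le hp c.X₁
  have e6 : entropy c.pmf (fun ω => (c.W₁ ω, c.local₂ ω)) = _ :=
    c.entropy_local_pair h₁ h₂ Prod.fst id
  change _ = entropy c.pmf c.W₁ + entropy c.pmf c.local₂ at e6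
  rw [c.entropy_W₁ h₁ h₂] at e6
  linarith

theorem entropy_Y₂_le (hmn : m ≤ n) (hnm : n ≤ 2 * m) (h₁ : c.M₁ ≠ 0) (h₂ : c.M₂ ≠ 0) :
    entropy c.pmf c.Y₂ ≤ entropy c.pmf c.top + N * (2 * m - n) := by
  have hp := c.pmf_mem h₁ h₂
  -- The levels of `Y₂` below the top `n - m`: those with index from `n - m` to `m - 1`.
  let mid : c.Sample → Fin N → Fin (2 * m - n) → ZMod 2 :=
    fun ω t i => c.X₂ ω t ⟨n - m + i, by omega⟩
  have e1 : entropy c.pmf c.Y₂ ≤ entropy c.pmf (fun ω => (c.top ω, mid ω)) :=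
    entropy_le_of_determines hp fun ω ω' h => by
      simp only [Prod.mk.injEq] at h
      funext t i
      simp only [Y₂, output₂_apply]
      by_cases hi : (i : ℕ) < n - m
      · exact congrFun (congrFun h.1 t) ⟨i, hi⟩
      · have := congrFun (congrFun h.2 t) ⟨i - (n - m), by omega⟩
        simp only [mid] at this
        convert this using 3 <;> omega
  have e2 := entropy_pair_le_add hp c.top mid
  have e3 := entropy_block_le hp mid
  rw [Nat.cast_sub hnm] at e3
  push_cast at e3
  linarith

/-- The top levels are a function of `Y₁`, so by secrecy they are independent of `W₂`; they are also
part of `Y₂`, since `n - m ≤ m`. Decoding `W₂` from `Y₂` thus leaves room only for `H(Y₂) - H(top)`.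
-/
theorem logb_M₂_le_entropy (hmn : m ≤ n) (hnm : n ≤ 2 * m) (h₁ : c.M₁ ≠ 0) (h₂ : c.M₂ ≠ 0)
    (hs : c.PerfectlySecret) :
    Real.logb 2 c.M₂ + entropy c.pmf c.top ≤
      entropy c.pmf c.Y₂ + 1 + c.err₂ * Real.logb 2 c.M₂ := by
  have hp := c.pmf_mem h₁ h₂
  have hF := c.fano₂ h₁ h₂
  have e1 := entropy_add_le_of_mutualInfo_eq_zero hp (Y₁_determines_top hmn) hs.2
  have e2 : entropy c.pmf (fun ω => (c.W₂ ω, c.top ω)) ≤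
      entropy c.pmf (fun ω => (c.W₂ ω, c.Y₂ ω)) :=
    entropy_le_of_determines hp fun ω ω' h => by
      simp only [Prod.mk.injEq] at h ⊢
      refine ⟨h.1, ?_⟩
      funext t i
      have := congrFun (congrFun h.2 t) ⟨i, by omega⟩
      simpa only [Y₂, output₂_apply, top] using this
  rw [c.entropy_W₂ h₁ h₂] at e1
  linarith

/-- Submodularity is applied conditionally on `(W₁, top)`. Given `local₁` and `V`, the input `X₁` is
known and `Y₁` yields `Y₂`, so `Y₁` retains at least `H(Y₂, V) - H(top, V)` bits not due to `W₁`;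
dropping `V` costs at most `N C`. -/
theorem logb_M₁_le_entropy (hmn : m ≤ n) (h₁ : c.M₁ ≠ 0) (h₂ : c.M₂ ≠ 0) :
    Real.logb 2 c.M₁ + entropy c.pmf c.Y₂ ≤
      entropy c.pmf c.top + N * (m + C) + 1 + c.err₁ * Real.logb 2 c.M₁ := by
  have hp := c.pmf_mem h₁ h₂
  have hF := c.fano₁ h₁ h₂
  let bot : c.Sample → Fin N → Fin m → ZMod 2 := fun ω t i => c.Y₁ ω t ⟨n - m + i, by omega⟩
  have e1 : entropy c.pmf c.Y₁ ≤ entropy c.pmf (fun ω => (c.top ω, bot ω)) :=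
    entropy_le_of_determines hp fun ω ω' h => by
      simp only [Prod.mk.injEq] at h
      funext t i
      by_cases hi : (i : ℕ) < n - m
      · simp only [Y₁, output₁_of_lt hmn _ _ i hi]
        exact congrFun (congrFun h.1 t) ⟨i, hi⟩
      · have := congrFun (congrFun h.2 t) ⟨i - (n - m), by omega⟩
        simp only [bot] at this
        convert this using 3 <;> omega
  have e2 := entropy_pair_le_add hp c.top bot
  have e3 := entropy_block_le hp bot
  -- the local randomness and the link signal only help receiver 1
  have hS := entropy_submodular hp c.Y₁ (fun ω => (c.local₁ ω, c.V ω)) (fun ω => (c.W₁ ω, c.top ω))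
  have e4 : entropy c.pmf (fun ω => (c.local₁ ω, (c.Y₂ ω, c.V ω))) ≤
      entropy c.pmf (fun ω => (c.Y₁ ω, (c.local₁ ω, c.V ω), (c.W₁ ω, c.top ω))) :=
    entropy_le_of_determines hp fun ω ω' h => by
      simp only [Prod.mk.injEq] at h ⊢
      exact ⟨h.2.1.1, Y₂_determined h.2.1.1 h.2.1.2 hmn h.1, h.2.1.2⟩
  have e5 : entropy c.pmf (fun ω => ((c.W₁ ω, c.top ω), (c.local₁ ω, c.V ω))) ≤
      entropy c.pmf (fun ω => (c.local₁ ω, (c.top ω, c.V ω))) :=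
    entropy_le_of_determines hp fun ω ω' h => by
      simp only [Prod.mk.injEq] at h ⊢
      have h1 := h.1
      simp only [local₁, Prod.mk.injEq] at h1
      exact ⟨⟨h1.1, h.2.1⟩, h.1, h.2.2⟩
  have e6 : entropy c.pmf (fun ω => ((c.W₁ ω, c.top ω), c.Y₁ ω)) ≤
      entropy c.pmf (fun ω => (c.W₁ ω, c.Y₁ ω)) :=
    entropy_le_of_determines hp fun ω ω' h => by
      simp only [Prod.mk.injEq] at h ⊢
      exact ⟨⟨h.1, Y₁_determines_top hmn _ _ h.2⟩, h.2⟩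
  have e7 : entropy c.pmf (fun ω => (c.W₁ ω, c.top ω)) =
      entropy c.pmf c.W₁ + entropy c.pmf c.top :=
    c.entropy_local_pair h₁ h₂ Prod.fst
      (fun b => fun t (i : Fin (n - m)) => c.enc₂ b.1 b.2 t ⟨i, by omega⟩)
  have e8 : entropy c.pmf (fun ω => (c.local₁ ω, (c.Y₂ ω, c.V ω))) =
      entropy c.pmf c.local₁ + entropy c.pmf (fun ω => (c.Y₂ ω, c.V ω)) :=
    c.entropy_local_pair h₁ h₂ id
      (fun b => (fun t => output₂ m n (c.enc₂ b.1 b.2 t), c.link b.1 b.2))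
  have e9 : entropy c.pmf (fun ω => (c.local₁ ω, (c.top ω, c.V ω))) =
      entropy c.pmf c.local₁ + entropy c.pmf (fun ω => (c.top ω, c.V ω)) :=
    c.entropy_local_pair h₁ h₂ id
      (fun b => (fun t (i : Fin (n - m)) => c.enc₂ b.1 b.2 t ⟨i, by omega⟩, c.link b.1 b.2))
  have e10 : entropy c.pmf c.Y₂ ≤ entropy c.pmf (fun ω => (c.Y₂ ω, c.V ω)) :=
    entropy_le_of_determines hp fun _ _ h => (Prod.mk.inj h).1
  have e11 := entropy_pair_le_add hp c.top c.V
  have e12 := entropy_block_le hp c.V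
  rw [c.entropy_W₁ h₁ h₂] at e7
  linarith

end Code

/-- Each achievable pair satisfies the outer bounds. -/
theorem IsAchievable.mem_region {m n C : ℕ} {R : ℝ × ℝ} (hmn : m ≤ n) (hnm : n ≤ 2 * m)
    (hR : IsAchievable m n C R) :
    0 ≤ R.1 ∧ 0 ≤ R.2 ∧ R.1 ≤ (m : ℝ) ∧ R.2 ≤ 2 * (m : ℝ) - (n : ℝ) ∧
      R.1 + R.2 ≤ (m : ℝ) + (C : ℝ) := by
  obtain ⟨h1, h2, hR⟩ := hR
  have hlim : ∀ a b : ℝ, (∀ ε : ℝ, 0 < ε → ε < 1 → ∃ N₀ : ℕ, ∀ N : ℕ, N₀ ≤ N →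
      (1 - ε) * (N * a) ≤ N * b + 2) → a ≤ b := by
    intro a b h
    have hε : ∀ ε : ℝ, 0 < ε → ε < 1 → (1 - ε) * a ≤ b := by
      intro ε h0 h1
      obtain ⟨N₀, hN⟩ := h ε h0 h1
      refine le_of_forall_pos_le_add fun δ hδ => ?_
      -- Beyond `2 / δ` the additive constant `2` is at most `N δ`.
      obtain ⟨k, hk⟩ := exists_nat_gt (2 / δ)
      have := hN (max N₀ (k + 1)) (le_max_left _ _)
      set N := max N₀ (k + 1)
      have hkN : (k : ℝ) + 1 ≤ N := by exact_mod_cast le_max_right N₀ (k + 1)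
      have hNpos : (0 : ℝ) < N := by have : (0 : ℝ) ≤ k := Nat.cast_nonneg k; linarith
      have h3 : 2 ≤ N * δ := by
        rw [div_lt_iff₀ hδ] at hk
        nlinarith
      nlinarith
    refine le_of_forall_pos_le_add fun δ hδ => ?_
    have hpos : 0 < |a| + δ + 1 := by positivity
    -- This `ε` is below `1` and satisfies `ε a ≤ δ`.
    have := hε (δ / (|a| + δ + 1)) (by positivity) (by rw [div_lt_one hpos]; linarith [abs_nonneg a])
    have h4 : δ / (|a| + δ + 1) * a ≤ δ := by
      rw [div_mul_eq_mul_div, div_le_iff₀ hpos]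
      nlinarith [le_abs_self a]
    linarith
  have hcode : ∀ ε : ℝ, 0 < ε → ε < 1 → ∃ N₀ : ℕ, ∀ N : ℕ, N₀ ≤ N →
      (1 - ε) * (N * R.1) ≤ N * m + 2 ∧ (1 - ε) * (N * R.2) ≤ N * (2 * m - n) + 2 ∧
        (1 - ε) * (N * (R.1 + R.2)) ≤ N * (m + C) + 2 := by
    intro ε h0 h1
    obtain ⟨N₀, hN⟩ := hR ε h0
    refine ⟨N₀, fun N hN' => ?_⟩
    obtain ⟨c, hM₁, hM₂, he₁, he₂, hs⟩ := hN N hN'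
    have p₁ : (0 : ℝ) < c.M₁ := lt_of_lt_of_le (by positivity) hM₁
    have p₂ : (0 : ℝ) < c.M₂ := lt_of_lt_of_le (by positivity) hM₂
    have n₁ : c.M₁ ≠ 0 := by exact_mod_cast p₁.ne'
    have n₂ : c.M₂ ≠ 0 := by exact_mod_cast p₂.ne'
    have l₁ : N * R.1 ≤ Real.logb 2 c.M₁ := by
      rwa [Real.le_logb_iff_rpow_le one_lt_two p₁]
    have l₂ : N * R.2 ≤ Real.logb 2 c.M₂ := by
      rwa [Real.le_logb_iff_rpow_le one_lt_two p₂]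
    have L₁ : 0 ≤ Real.logb 2 c.M₁ := le_trans (by positivity) l₁
    have L₂ : 0 ≤ Real.logb 2 c.M₂ := le_trans (by positivity) l₂
    have b₁ := c.logb_M₁_le n₁ n₂
    have b₂ := c.entropy_Y₂_le hmn hnm n₁ n₂
    have b₃ := c.logb_M₂_le_entropy hmn hnm n₁ n₂ hs
    have b₄ := c.logb_M₁_le_entropy hmn n₁ n₂
    have q₁ := mul_le_mul_of_nonneg_right he₁ L₁
    have q₂ := mul_le_mul_of_nonneg_right he₂ L₂
    have r₁ := mul_le_mul_of_nonneg_left l₁ (sub_nonneg.2 h1.le)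
    have r₂ := mul_le_mul_of_nonneg_left l₂ (sub_nonneg.2 h1.le)
    -- In the second bound `H(top)` cancels between `b₂` and `b₃`; in the third, `b₃ + b₄` cancels
    -- both `H(Y₂)` and `H(top)`. The two Fano constants give the `2`.
    refine ⟨by linarith, by linarith, by linarith⟩
  refine ⟨h1, h2, hlim _ _ fun ε h0 h1 => ?_, hlim _ _ fun ε h0 h1 => ?_,
    hlim _ _ fun ε h0 h1 => ?_⟩ <;> obtain ⟨N₀, hN⟩ := hcode ε h0 h1
  exacts [⟨N₀, fun N h => (hN N h).1⟩, ⟨N₀, fun N h => (hN N h).2.1⟩, ⟨N₀, fun N h => (hN N h).2.2⟩]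

end ZIC
-- Achievability by cancelling and jamming
namespace ZIC

theorem Code.sum_sample {m n C N : ℕ} (c : Code m n C N) (F : c.Sample → ℝ) :
    ∑ ω, F ω = ∑ b : Fin c.M₂ × Fin c.K₂, ∑ w, ∑ u, F ((w, b.1), (u, b.2)) := by
  simp only [Fintype.sum_prod_type]
  rw [Finset.sum_comm]
  refine Finset.sum_congr rfl fun w₂ _ => ?_
  rw [Finset.sum_comm]
  conv_rhs => rw [Finset.sum_comm]
  rw [Finset.sum_comm]
  exact Finset.sum_congr rfl fun w _ => Finset.sum_comm

/-- If the uniform local randomness of transmitter 1 acts as a one-time pad on what transmitter 2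
sends, then receiver 1 learns nothing about the message of user 2. -/
theorem Code.mutualInfo_W₂_Y₁_eq_zero {m n C N : ℕ} (c : Code m n C N) (h₁ : c.M₁ ≠ 0)
    (h₂ : c.M₂ ≠ 0) (hunif : ∀ u u', c.p₁ u = c.p₁ u')
    (σ : Fin c.M₂ × Fin c.K₂ → Equiv.Perm (Fin c.K₁))
    (g : Fin c.M₁ → Fin c.K₁ → Fin N → Fin (max m n) → ZMod 2)
    (hY : ∀ ω, c.Y₁ ω = g ω.1.1 (σ (c.local₂ ω) ω.2.1)) :
    mutualInfo c.pmf c.W₂ c.Y₁ = 0 := by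
  classical
  have hp := c.pmf_mem h₁ h₂
  have key : ∀ (ψ : Fin c.M₂ × Fin c.K₂ → ℝ) (y : Fin N → Fin (max m n) → ZMod 2),
      ∑ ω, c.pmf ω * (ψ (c.local₂ ω) * if c.Y₁ ω = y then 1 else 0) =
        (∑ b, 1 / (c.M₂ : ℝ) * c.p₂ b.2 * ψ b) *
          ∑ w, ∑ u, 1 / (c.M₁ : ℝ) * c.p₁ u * if g w u = y then 1 else 0 := by
    intro ψ y
    rw [c.sum_sample, Finset.sum_mul]
    refine Finset.sum_congr rfl fun ⟨b₁, b₂⟩ _ => ?_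
    rw [Finset.mul_sum]
    refine Finset.sum_congr rfl fun w _ => ?_
    -- For fixed data of transmitter 2, reindexing by `σ` preserves the uniform law of `u` and
    -- removes the data from the output.
    rw [Finset.mul_sum, ← Equiv.sum_comp (σ (b₁, b₂)) fun u =>
      1 / (c.M₂ : ℝ) * c.p₂ b₂ * ψ (b₁, b₂) * (1 / (c.M₁ : ℝ) * c.p₁ u * if g w u = y then 1 else 0)]
    refine Finset.sum_congr rfl fun u _ => ?_
    have hy : c.Y₁ ((w, b₁), (u, b₂)) = g w (σ (b₁, b₂) u) := hY _
    rw [hunif (σ (b₁, b₂) u) u]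
    by_cases h : g w (σ (b₁, b₂) u) = y
    · rw [if_pos h, if_pos (hy.trans h)]
      simp only [pmf, local₂]
      ring
    · rw [if_neg h, if_neg (hy ▸ h)]
      ring
  have hYp : ∀ y, prob c.pmf {ω | c.Y₁ ω = y} =
      ∑ w, ∑ u, 1 / (c.M₁ : ℝ) * c.p₁ u * if g w u = y then 1 else 0 := by
    intro y
    have := key (fun _ => 1) y
    simp only [mul_one, c.sum_local₂ h₂, one_mul] at this
    rw [← this, prob_eq_sum]
    refine Finset.sum_congr rfl fun ω _ => ?_
    by_cases h : c.Y₁ ω = y <;> simp [h]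
  refine mutualInfo_eq_zero_of_indep hp fun w y => ?_
  have hW : prob c.pmf {ω | c.W₂ ω = w} = _ := c.prob_local₂ h₁ {b | b.1 = w}
  rw [hYp, hW, ← key, prob_eq_sum]
  refine Finset.sum_congr rfl fun ω _ => ?_
  by_cases h : c.W₂ ω = w <;> by_cases h' : c.Y₁ ω = y <;>
    simp [h, h', show (c.local₂ ω).1 = c.W₂ ω from rfl]

section Scheme

variable {m n N : ℕ} (A : Finset (Fin N × Fin m))

/-- Data positions of user 2 whose data is not known to transmitter 1 over a link of capacity `C`
per channel use: there transmitter 1 sends random bits. -/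
def jammed (C : ℕ) : Finset (Fin N × Fin m) := A.filter fun a => C ≤ a.2

/-- The data of user 2 as a block, with zeros outside the data positions. -/
def dataBlock (w : A → ZMod 2) (t : Fin N) (j : Fin m) : ZMod 2 :=
  if h : (t, j) ∈ A then w ⟨(t, j), h⟩ else 0

/-- The data block carried by the levels from `n - m` on. -/
def schemeInput₂ (n : ℕ) (w : A → ZMod 2) (t : Fin N) (i : Fin (max m n)) : ZMod 2 :=
  if n - m ≤ (i : ℕ) ∧ (i : ℕ) < n then
    if h' : (i : ℕ) - (n - m) < m then dataBlock A w t ⟨i - (n - m), h'⟩ else 0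
  else 0

/-- The first `C` levels of the data block. -/
def schemeLink (C : ℕ) (w : A → ZMod 2) (t : Fin N) (k : Fin C) : ZMod 2 :=
  if h : (k : ℕ) < m then dataBlock A w t ⟨k, h⟩ else 0

/-- Random bits in the jammed positions; in the others, the message with the interference known
from the link cancelled. -/
def schemeInput₁ (C : ℕ) (w : {a // a ∉ jammed A C} → ZMod 2) (u : jammed A C → ZMod 2)
    (v : Fin N → Fin C → ZMod 2) (t : Fin N) (j : Fin m) : ZMod 2 :=
  if h : (t, j) ∈ jammed A C then u ⟨(t, j), h⟩
  else w ⟨(t, j), h⟩ + if h' : (j : ℕ) < C then v t ⟨j, h'⟩ else 0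

/-- What receiver 1 observes. -/
def schemeOutput₁ (n C : ℕ) (w : {a // a ∉ jammed A C} → ZMod 2) (u : jammed A C → ZMod 2)
    (t : Fin N) (i : Fin (max m n)) : ZMod 2 :=
  if h : n - m ≤ (i : ℕ) ∧ (i : ℕ) - (n - m) < m then
    if h' : (t, (⟨i - (n - m), h.2⟩ : Fin m)) ∈ jammed A C then u ⟨_, h'⟩ else w ⟨_, h'⟩
  else 0

/-- On a jammed level the data only shifts the random bit. On any other level the link term cancels
the data, or there is no data: a position of `A` outside the jammed set has level below `C`. -/
theorem output₁_scheme (hmn : m ≤ n) (C : ℕ) (w₁ : {a // a ∉ jammed A C} → ZMod 2)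
    (u : jammed A C → ZMod 2) (w₂ : A → ZMod 2) (t : Fin N) :
    output₁ m n (schemeInput₁ A C w₁ u (schemeLink A C w₂) t) (schemeInput₂ A n w₂ t) =
      schemeOutput₁ A n C w₁ (u + fun a => dataBlock A w₂ a.1.1 a.1.2) t := by
  funext i
  by_cases hi : (i : ℕ) < n - m
  · rw [output₁_of_lt hmn _ _ _ hi, schemeInput₂, schemeOutput₁, if_neg (by omega),
      dif_neg (by omega)]
  · have hi' := not_lt.1 hi
    have hj : (i : ℕ) - (n - m) < m := by omega
    rw [output₁_of_le hmn _ _ _ hi', schemeInput₂, schemeOutput₁, if_pos ⟨hi', by omega⟩,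
      dif_pos hj, dif_pos ⟨hi', hj⟩, schemeInput₁]
    split_ifs with h1 h2
    · rfl
    · rw [schemeLink, dif_pos hj, add_assoc, CharTwo.add_self_eq_zero, add_zero]
    · have : (t, (⟨i - (n - m), hj⟩ : Fin m)) ∉ A := fun h =>
        h1 (Finset.mem_filter.2 ⟨h, not_lt.1 h2⟩)
      rw [dataBlock, dif_neg this, add_zero, add_zero]

/-- The code with data positions `A`. -/
noncomputable def schemeCode (C : ℕ) (hA : ∀ a ∈ A, n - m + (a.2 : ℕ) < m) (hmn : m ≤ n) : Code m n C N where
  M₁ := Fintype.card ({a // a ∉ jammed A C} → ZMod 2)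
  M₂ := Fintype.card (A → ZMod 2)
  K₁ := Fintype.card (jammed A C → ZMod 2)
  K₂ := 1
  p₁ := fun _ => (Fintype.card (jammed A C → ZMod 2) : ℝ)⁻¹
  p₁_mem := ⟨fun _ => by positivity, by simp⟩
  p₂ := fun _ => 1
  p₂_mem := ⟨fun _ => zero_le_one, by simp⟩
  link := fun w _ => schemeLink A C ((Fintype.equivFin _).symm w)
  enc₁ := fun w u v => schemeInput₁ A C ((Fintype.equivFin _).symm w) ((Fintype.equivFin _).symm u) v
  causal := fun w u v v' t h => by
    funext j
    simp only [schemeInput₁, h t le_rfl]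
  enc₂ := fun w _ => schemeInput₂ A n ((Fintype.equivFin _).symm w)
  dec₁ := fun y => Fintype.equivFin _ fun a => y a.1.1 ⟨n - m + a.1.2, by omega⟩
  dec₂ := fun y => Fintype.equivFin _ fun a => y a.1.1 ⟨n - m + a.1.2, hA a a.2⟩

variable {A} {C : ℕ} (hA : ∀ a ∈ A, n - m + (a.2 : ℕ) < m) (hmn : m ≤ n)

theorem schemeCode_Y₁ (ω : (schemeCode A C hA hmn).Sample) : (schemeCode A C hA hmn).Y₁ ω =
    schemeOutput₁ A n C ((Fintype.equivFin _).symm ω.1.1) ((Fintype.equivFin _).symm ω.2.1 +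
      fun a => dataBlock A ((Fintype.equivFin _).symm ω.1.2) a.1.1 a.1.2) :=
  funext fun t => output₁_scheme A hmn C _ _ _ t

theorem schemeCode_err₁ : (schemeCode A C hA hmn).err₁ = 0 := by
  have : {ω | (schemeCode A C hA hmn).dec₁ ((schemeCode A C hA hmn).Y₁ ω) ≠
      (schemeCode A C hA hmn).W₁ ω} = ∅ := by
    refine Set.eq_empty_of_forall_notMem fun ω hω => hω ?_
    rw [schemeCode_Y₁]
    refine (Equiv.eq_symm_apply _).1 (funext fun a => ?_)
    have ha : (a.1.1, (⟨n - m + (a.1.2 : ℕ) - (n - m), by omega⟩ : Fin m)) = a.1 :=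
      Prod.ext rfl (Fin.ext (by simp))
    rw [schemeOutput₁, dif_pos (by simp), dif_neg (by simpa only [ha] using a.2)]
    exact congrArg _ (Subtype.ext ha)
  rw [Code.err₁, this]
  simp [prob]

theorem schemeCode_err₂ : (schemeCode A C hA hmn).err₂ = 0 := by
  have : {ω | (schemeCode A C hA hmn).dec₂ ((schemeCode A C hA hmn).Y₂ ω) ≠
      (schemeCode A C hA hmn).W₂ ω} = ∅ := by
    refine Set.eq_empty_of_forall_notMem fun ω hω => hω ?_
    refine (Equiv.eq_symm_apply _).1 (funext fun a => ?_)
    have ha : (a.1.1, (⟨n - m + (a.1.2 : ℕ) - (n - m), by omega⟩ : Fin m)) = a.1 :=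
      Prod.ext rfl (Fin.ext (by simp))
    have hlt := hA a a.2
    simp only [Code.Y₂, output₂_apply]
    change schemeInput₂ A n ((Fintype.equivFin _).symm ω.1.2) a.1.1 _ = _
    rw [schemeInput₂, if_pos ⟨by simp, by simp; omega⟩, dif_pos (by simp), dataBlock,
      dif_pos (by simpa only [ha] using a.2)]
    exact congrArg _ (Subtype.ext ha)
  rw [Code.err₂, this]
  simp [prob]

/-- Transmitter 1 does not influence `Y₂`. In `Y₁` the data of user 2 appears only as a shift of the
uniform jamming bits, hence as a permutation of their values. -/
theorem schemeCode_perfectlySecret : (schemeCode A C hA hmn).PerfectlySecret := by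
  have h₁ : (schemeCode A C hA hmn).M₁ ≠ 0 := Fintype.card_ne_zero
  have h₂ : (schemeCode A C hA hmn).M₂ ≠ 0 := Fintype.card_ne_zero
  refine ⟨Code.mutualInfo_local_eq_zero _ h₁ h₂ Prod.fst
    (fun b t => output₂ m n ((schemeCode A C hA hmn).enc₂ b.1 b.2 t)), ?_⟩
  refine Code.mutualInfo_W₂_Y₁_eq_zero _ h₁ h₂ (fun _ _ => rfl)
    (fun b => (Fintype.equivFin (jammed A C → ZMod 2)).permCongr
      (Equiv.addRight fun a => dataBlock A ((Fintype.equivFin _).symm b.1) a.1.1 a.1.2))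
    (fun w u => schemeOutput₁ A n C ((Fintype.equivFin _).symm w) ((Fintype.equivFin _).symm u))
    fun ω => ?_
  exact (schemeCode_Y₁ hA hmn ω).trans
    (congrArg (schemeOutput₁ A n C _) (Equiv.symm_apply_apply _ _).symm)

end Scheme

/-- Zero-error codes with `s` bits of user 2 in the levels that both receivers observe. -/
theorem exists_code {m n : ℕ} (hmn : m ≤ n) (hnm : n ≤ 2 * m) (C N s : ℕ)
    (hs : N * min C (2 * m - n) ≤ s) (hs' : s ≤ N * (2 * m - n)) :
    ∃ c : Code m n C N, c.M₁ = 2 ^ (N * m - (s - N * min C (2 * m - n))) ∧ c.M₂ = 2 ^ s ∧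
      c.err₁ = 0 ∧ c.err₂ = 0 ∧ c.PerfectlySecret := by
  classical
  have hcard : ∀ k ≤ m,
      (Finset.univ.filter fun a : Fin N × Fin m => (a.2 : ℕ) < k).card = N * k := by
    intro k hk
    have : (Finset.univ.filter fun a : Fin N × Fin m => (a.2 : ℕ) < k) =
        Finset.univ ×ˢ (Finset.univ.filter fun j : Fin m => (j : ℕ) < k) := by
      ext; simp
    rw [this, Finset.card_product, Fin.card_filter_val_lt]
    simp [hk]
  -- `A` contains every usable position known through the link, so exactly `s - N * min C (2 * m -
  -- n)` positions must be jammed; it stays within the levels seen by both receivers.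
  obtain ⟨A, hA₁, hA₂, hA⟩ := Finset.exists_subsuperset_card_eq
    (s := Finset.univ.filter fun a : Fin N × Fin m => (a.2 : ℕ) < min C (2 * m - n))
    (t := Finset.univ.filter fun a : Fin N × Fin m => (a.2 : ℕ) < 2 * m - n) (n := s)
    (fun a ha => by simp at ha ⊢; omega) (by rw [hcard _ (by omega)]; exact hs)
    (by rw [hcard _ (by omega)]; exact hs')
  have hA₃ : ∀ a ∈ A, n - m + (a.2 : ℕ) < m := fun a ha => by
    have := hA₂ ha
    simp at this
    omega
  have hJ : jammed A C =
      A \ Finset.univ.filter fun a : Fin N × Fin m => (a.2 : ℕ) < min C (2 * m - n) := by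
    ext a
    have : a ∈ A → (a.2 : ℕ) < 2 * m - n := fun h => by simpa using hA₂ h
    simp only [jammed, Finset.mem_filter, Finset.mem_sdiff, Finset.mem_univ, true_and]
    refine and_congr_right fun h => ?_
    have := this h
    omega
  have hJc : (jammed A C).card = s - N * min C (2 * m - n) := by
    rw [hJ, Finset.card_sdiff_of_subset hA₁, hcard _ (by omega), hA]
  refine ⟨schemeCode A C hA₃ hmn, ?_, ?_, schemeCode_err₁ _ _, schemeCode_err₂ _ _,
    schemeCode_perfectlySecret _ _⟩
  · change Fintype.card ({a // a ∉ jammed A C} → ZMod 2) = _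
    rw [Fintype.card_fun, ZMod.card, Fintype.card_subtype_compl, Fintype.card_coe, hJc]
    simp
  · change Fintype.card (A → ZMod 2) = _
    rw [Fintype.card_fun, ZMod.card, Fintype.card_coe, hA]

/-- Rounding `N R₂` up to whole bits is the only loss in the scheme, so the sum constraint is
required with the ceiling. -/
theorem isAchievable_of_ceil_le {m n C : ℕ} (hmn : m ≤ n) (hnm : n ≤ 2 * m) {R : ℝ × ℝ}
    (h₁ : 0 ≤ R.1) (h₂ : 0 ≤ R.2) (hR₁ : R.1 ≤ m) (hR₂ : R.2 ≤ 2 * m - n)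
    (hceil : ∃ N₀ : ℕ, ∀ N : ℕ, N₀ ≤ N → N * R.1 + ⌈N * R.2⌉₊ ≤ N * ((m : ℝ) + C)) :
    IsAchievable m n C R := by
  refine ⟨h₁, h₂, fun ε hε => ?_⟩
  obtain ⟨N₀, hN₀⟩ := hceil
  refine ⟨N₀, fun N hN => ?_⟩
  have hL : N * R.2 ≤ ((N * (2 * m - n) : ℕ) : ℝ) := by
    rw [Nat.cast_mul, Nat.cast_sub hnm]
    push_cast
    exact mul_le_mul_of_nonneg_left hR₂ (Nat.cast_nonneg _)
  have hceilL : ⌈N * R.2⌉₊ ≤ N * (2 * m - n) := Nat.ceil_le.2 hL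
  have hmin : N * min C (2 * m - n) ≤ N * (2 * m - n) := Nat.mul_le_mul_left _ (min_le_right _ _)
  -- Fewer bits than the link can carry would not help user 1, so user 2 sends at least `N * min C
  -- (2 * m - n)`.
  obtain ⟨c, hM₁, hM₂, he₁, he₂, hsec⟩ := exists_code hmn hnm C N
    (max (N * min C (2 * m - n)) ⌈N * R.2⌉₊) (le_max_left _ _) (max_le hmin hceilL)
  refine ⟨c, ?_, ?_, he₁.trans_le hε.le, he₂.trans_le hε.le, hsec⟩
  · rw [hM₁]
    push_cast
    rw [← Real.rpow_natCast]
    refine Real.rpow_le_rpow_of_exponent_le one_le_two ?_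
    rcases le_total ⌈N * R.2⌉₊ (N * min C (2 * m - n)) with h | h
    · rw [max_eq_left h, Nat.sub_self, Nat.sub_zero, Nat.cast_mul]
      exact mul_le_mul_of_nonneg_left hR₁ (Nat.cast_nonneg _)
    · rw [max_eq_right h]
      rcases le_total C (2 * m - n) with hC | hC
      · rw [min_eq_left hC] at h ⊢
        have hm : N * (2 * m - n) ≤ N * m := Nat.mul_le_mul_left _ (by omega)
        rw [Nat.cast_sub (by omega), Nat.cast_sub h]
        push_cast
        linarith [hN₀ N hN]
      -- The link covers all data levels, so nothing is jammed and user 1 keeps all `N m` bits.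
      · rw [min_eq_right hC] at h ⊢
        rw [le_antisymm hceilL h, Nat.sub_self, Nat.sub_zero, Nat.cast_mul]
        exact mul_le_mul_of_nonneg_left hR₁ (Nat.cast_nonneg _)
  · rw [hM₂]
    push_cast
    rw [← Real.rpow_natCast]
    refine Real.rpow_le_rpow_of_exponent_le one_le_two ?_
    exact (Nat.le_ceil _).trans (Nat.cast_le.2 (le_max_right _ _))

theorem isAchievable_of_add_lt {m n C : ℕ} (hmn : m ≤ n) (hnm : n ≤ 2 * m) {R : ℝ × ℝ}
    (h₁ : 0 ≤ R.1) (h₂ : 0 ≤ R.2) (hR₁ : R.1 ≤ m) (hR₂ : R.2 ≤ 2 * m - n)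
    (hR : R.1 + R.2 < (m : ℝ) + C) : IsAchievable m n C R := by
  refine isAchievable_of_ceil_le hmn hnm h₁ h₂ hR₁ hR₂ ?_
  have hδ : 0 < (m : ℝ) + C - (R.1 + R.2) := sub_pos.2 hR
  -- From this block length on, the slack in the sum rate is worth at least the one bit lost in
  -- rounding.
  obtain ⟨k, hk⟩ := exists_nat_ge (1 / ((m : ℝ) + C - (R.1 + R.2)))
  refine ⟨k, fun N hN => ?_⟩
  have h3 := Nat.ceil_lt_add_one (mul_nonneg (Nat.cast_nonneg N) h₂)
  have h4 : 1 ≤ N * ((m : ℝ) + C - (R.1 + R.2)) := by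
    rw [← div_le_iff₀ hδ]
    exact hk.trans (Nat.cast_le.2 hN)
  linarith

theorem isAchievable_of_natCast {m n C k : ℕ} (hmn : m ≤ n) (hnm : n ≤ 2 * m) {R : ℝ × ℝ}
    (h₁ : 0 ≤ R.1) (hk : R.2 = k) (hR₁ : R.1 ≤ m) (hR₂ : R.2 ≤ 2 * m - n)
    (hR : R.1 + R.2 ≤ (m : ℝ) + C) : IsAchievable m n C R := by
  refine isAchievable_of_ceil_le hmn hnm h₁ (hk ▸ Nat.cast_nonneg k) hR₁ hR₂ ⟨0, fun N _ => ?_⟩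
  rw [hk, ← Nat.cast_mul, Nat.ceil_natCast, Nat.cast_mul, ← mul_add]
  rw [hk] at hR
  exact mul_le_mul_of_nonneg_left hR (Nat.cast_nonneg _)

theorem isClosed_region (m n C : ℝ) :
    IsClosed {R : ℝ × ℝ | 0 ≤ R.1 ∧ 0 ≤ R.2 ∧ R.1 ≤ m ∧ R.2 ≤ 2 * m - n ∧ R.1 + R.2 ≤ m + C} := by
  simp only [Set.ofPred_and]
  exact (isClosed_le continuous_const continuous_fst).inter <|
    (isClosed_le continuous_const continuous_snd).inter <|
    (isClosed_le continuous_fst continuous_const).inter <|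
    (isClosed_le continuous_snd continuous_const).inter
    (isClosed_le (continuous_fst.add continuous_snd) continuous_const)

end ZIC

theorem theorem2 (m n C : ℕ) (hα₁ : 1 < (n : ℝ) / (m : ℝ)) (hα₂ : (n : ℝ) / (m : ℝ) < 2) :
    ZIC.secrecyCapacityRegion m n C =
        {R : ℝ × ℝ | 0 ≤ R.1 ∧ 0 ≤ R.2 ∧ R.1 ≤ (m : ℝ) ∧ R.2 ≤ 2 * (m : ℝ) - (n : ℝ) ∧
          R.1 + R.2 ≤ (m : ℝ) + (C : ℝ)} ∧
      ((C : ℝ) ≤ 2 * (m : ℝ) - (n : ℝ) →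
        ZIC.IsAchievable m n C ((m : ℝ), (C : ℝ)) ∧
        ZIC.IsAchievable m n C ((C : ℝ) + (n : ℝ) - (m : ℝ), 2 * (m : ℝ) - (n : ℝ))) := by
  have hm : (0 : ℝ) < m := by
    rcases Nat.eq_zero_or_pos m with h | h
    · norm_num [h] at hα₁
    · exact_mod_cast h
  rw [one_lt_div hm] at hα₁
  rw [div_lt_iff₀ hm] at hα₂
  have hmn : m ≤ n := by exact_mod_cast hα₁.le
  have hnm : n ≤ 2 * m := by exact_mod_cast hα₂.le
  have hC : (0 : ℝ) ≤ C := Nat.cast_nonneg C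
  refine ⟨Set.Subset.antisymm ?_ ?_, fun hCL => ⟨?_, ?_⟩⟩
  · exact closure_minimal (fun R hR => ZIC.IsAchievable.mem_region hmn hnm hR)
      (ZIC.isClosed_region m n C)
  · rintro R ⟨h1, h2, h3, h4, h5⟩
    -- Scaling by `r < 1` makes the sum constraint strict, because `m + C > 0`; the point itself is
    -- the limit as `r` tends to `1`.
    have hlim : Filter.Tendsto (fun r : ℝ => r • R) (nhdsWithin 1 (Set.Iio 1)) (nhds R) := by
      have : Filter.Tendsto (fun r : ℝ => r • R) (nhds 1) (nhds ((1 : ℝ) • R)) :=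
        (continuous_id.smul continuous_const).tendsto 1
      rw [one_smul] at this
      exact this.mono_left nhdsWithin_le_nhds
    refine mem_closure_of_tendsto hlim ?_
    filter_upwards [Ioo_mem_nhdsLT (show (0 : ℝ) < 1 from one_pos)] with r hr
    have hr0 : 0 < r := hr.1
    have hr1 : r < 1 := hr.2
    refine ZIC.isAchievable_of_add_lt hmn hnm ?_ ?_ ?_ ?_ ?_ <;>
      simp only [Prod.smul_fst, Prod.smul_snd, smul_eq_mul]
    · positivity
    · positivity
    · nlinarith
    · nlinarith
    · nlinarith
  -- At both corner points `R₂` is an integer, so no rounding occurs and the closure is not needed.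
  · exact ZIC.isAchievable_of_natCast (k := C) hmn hnm hm.le rfl le_rfl hCL le_rfl
  · refine ZIC.isAchievable_of_natCast (k := 2 * m - n) hmn hnm ?_ ?_ ?_ le_rfl ?_ <;> dsimp only
    · linarith
    · rw [Nat.cast_sub hnm]
      push_cast
      rfl
    · linarith
    · linarith
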